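/- A function $\Phi\colon[0,\infty)\to[0,\infty)$ is a $\Phi$-function if it is increasing (not necessarily strictly), $\Phi(0)=0$, $\lim_{t\to0+}\Phi(t)=0$, $\lim_{t\to\infty}\Phi(t)=\infty$ and $\Phi\in(\mathrm{aInc})_1$, where $\Phi\in(\mathrm{aInc})_p$ means that there is $a\ge1$ with $\Phi(s)s^{-p}\le a\,\Phi(t)t^{-p}$ for all $0<s<t$; any such $a$ is an admissible value of the constant $a_\Phi(p)$. Let $\Omega\subset\mathbb R^d$ be compact, let $\mu$ be a Borel probability measure on $\Omega$, and let $C(\Omega)$ be the space of continuous scalar functions on $\Omega$ (scalars $\mathbb K=\mathbb R$ or $\mathbb C$). Put $$\|f\|_{L^\Phi(\mu)}=\inf\Bigl\{\lambda>0:\int_\Omega\Phi(|f|/\lambda)\,d\mu\le1\Bigr\},$$ and let $L^\Phi(\mu)$ be the space of measurable $f$ with $\int_\Omega\Phi(|f|/\lambda)\,d\mu<\infty$ for some $\lambda>0$. A number $C_\Phi$ is called a quasi-triangle constant for $L^\Phi(\mu)$ if $\|f+g\|_{L^\Phi(\mu)}\le C_\Phi(\|f\|_{L^\Phi(\mu)}+\|g\|_{L^\Phi(\mu)})$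 for all $f,g\in L^\Phi(\mu)$. For $\mathbf F\subset C(\Omega)$ the linear sampling numbers and the Kolmogorov widths are $$\varrho_m(\mathbf F,\|\cdot\|_{L^\Phi(\mu)})=\inf_{\mathbf x\subset\Omega,\ \#\mathbf x\le m}\ \inf_{T\colon\mathbb K^{\mathbf x}\to L^\Phi(\mu)\text{ linear}}\ \sup_{f\in\mathbf F}\|f-T(f|_{\mathbf x})\|_{L^\Phi(\mu)},\qquad d_N(\mathbf F,\|\cdot\|_\infty)=\inf_{X}\sup_{f\in\mathbf F}d(f,X)_\infty,$$ where $X$ runs over the linear subspaces of $C(\Omega)$ of dimension at most $N$ and $d(f,X)_\infty=\inf_{u\in X}\|f-u\|_\infty$. All these quantities take values in $[0,\infty]$. **Theorem.** There are numerical constants $c\in\mathbb N$, $c\ge1$, and $C\ge1$ such that the following holds for every $p\in[2,\infty)$ and every $\Phi$-function $\Phi\in(\mathrm{aInc})_p$ with $\Phi(1)>0$. There is a number $C(\Phi,p)\ge1$, depending only on $\Phi$ and $p$, such that for every $N\ge1$, every compact $\Omega\subset\mathbb R^d$ ($d$ arbitrary), every Borel probability measure $\mu$ on $\Omega$ and every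 $\mathbf F\subset C(\Omega)$, $$\varrho_{cN}(\mathbf F,\|\cdot\|_{L^\Phi(\mu)})\le C(\Phi,p)\Bigl(\frac{\Phi(\sqrt N)}{N}\Bigr)^{1/p}d_N(\mathbf F,\|\cdot\|_\infty).$$ The recovery can be done by least squares: for every $N$-dimensional subspace $X_N\subset C(\Omega)$ there are points $x_1,\dots,x_k\in\Omega$ (possibly repeated), $k\le cN$, such that for all data $y\in\mathbb K^k$ the minimizer $\ell(y)$ of $\sum_{j=1}^k|y_j-u(x_j)|^2$ over $u\in X_N$ exists, is unique and is linear in $y$, and $$\|f-\ell(f(x_1),\dots,f(x_k))\|_{L^\Phi(\mu)}\le C(\Phi,p)\Bigl(\frac{\Phi(\sqrt N)}{N}\Bigr)^{1/p}d(f,X_N)_\infty\qquad\text{for all }f\in C(\Omega).$$ Moreover, in both inequalities $C(\Phi,p)$ can be replaced by $$C\cdot C_\Phi\,a_\Phi(p)^{2/p}\bigl(1+\Phi(1)^{-1}\bigr)^{1/p},$$ where $a_\Phi(p)$ is any admissible constant in $\Phi\in(\mathrm{aInc})_p$ and $C_\Phi$ is any quasi-triangle constant for $L^\Phi(\mu)$.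 -/

import Mathlib

open MeasureTheory Filter Topology
open scoped NNReal ENNReal

namespace Orlicz

/-- `t ↦ Φ(t) t⁻ᵖ` is almost increasing on `(0, ∞)` with the constant `a ≥ 1`, i.e. `a` is an
admissible value of the constant `a_Φ(p)`. -/
def AIncWith (Φ : ℝ≥0 → ℝ≥0) (p : ℝ) (a : ℝ≥0) : Prop :=
  1 ≤ a ∧ ∀ s t : ℝ≥0, 0 < s → s < t → Φ s / s ^ p ≤ a * (Φ t / t ^ p)

/-- The class `(aInc)_p`. -/
def AInc (Φ : ℝ≥0 → ℝ≥0) (p : ℝ) : Prop :=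
  ∃ a : ℝ≥0, AIncWith Φ p a

/-- `Φ : [0, ∞) → [0, ∞)` is a (weak) `Φ`-function: it is increasing (not necessarily strictly),
`Φ(0) = 0`, `Φ(t) → 0` as `t → 0+`, `Φ(t) → ∞` as `t → ∞`, and `Φ ∈ (aInc)_1`. -/
structure IsPhiFunction (Φ : ℝ≥0 → ℝ≥0) : Prop where
  monotone : Monotone Φ
  map_zero : Φ 0 = 0
  tendsto_zero : Tendsto Φ (𝓝[>] 0) (𝓝 0)
  tendsto_atTop : Tendsto Φ atTop atTop
  aInc_one : AInc Φ 1

section Space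

variable {𝕜 Ω : Type*} [RCLike 𝕜] [MeasurableSpace Ω] [TopologicalSpace Ω]

/-- The modular `ρ_Φ(f / l) = ∫ Φ(|f| / l) dμ`, with values in `[0, ∞]`. -/
noncomputable def modular (Φ : ℝ≥0 → ℝ≥0) (μ : Measure Ω) (f : Ω → 𝕜) (l : ℝ≥0) : ℝ≥0∞ :=
  ∫⁻ x, (Φ (‖f x‖₊ / l) : ℝ≥0∞) ∂μ

/-- Membership in the Orlicz space `L^Φ(μ)`. -/
def MemOrlicz (Φ : ℝ≥0 → ℝ≥0) (μ : Measure Ω) (f : Ω → 𝕜) : Prop :=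
  AEStronglyMeasurable f μ ∧ ∃ l : ℝ≥0, 0 < l ∧ modular Φ μ f l < ∞

/-- The Luxemburg functional `‖f‖_{L^Φ(μ)} = inf {l > 0 : ρ_Φ(f / l) ≤ 1}`, with values in `[0, ∞]`
(the infimum of the empty set is `∞`). -/
noncomputable def luxNorm (Φ : ℝ≥0 → ℝ≥0) (μ : Measure Ω) (f : Ω → 𝕜) : ℝ≥0∞ :=
  ⨅ (l : ℝ≥0) (_ : 0 < l ∧ modular Φ μ f l ≤ 1), (l : ℝ≥0∞)

/-- `K` is an admissible constant in the quasi-triangle inequality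
`‖f + g‖_Φ ≤ K (‖f‖_Φ + ‖g‖_Φ)`, `f, g ∈ L^Φ(μ)`. -/
def IsQuasiTriangleConst (𝕜 : Type*) [RCLike 𝕜] (Φ : ℝ≥0 → ℝ≥0) (μ : Measure Ω) (K : ℝ≥0) : Prop :=
  ∀ f g : Ω → 𝕜, MemOrlicz Φ μ f → MemOrlicz Φ μ g →
    luxNorm Φ μ (f + g) ≤ K * (luxNorm Φ μ f + luxNorm Φ μ g)

/-- The (linear) sampling number `ϱ_m(F, ‖·‖_{L^Φ(μ)})`: the infimum, over sets `x` of at most `m`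
points of `Ω` and over linear maps `T` from the space `𝕜^x` of samples to `L^Φ(μ)`, of the worst
case error `sup_{f ∈ F} ‖f - T (f|_x)‖_{L^Φ(μ)}`. -/
noncomputable def samplingNumber (Φ : ℝ≥0 → ℝ≥0) (μ : Measure Ω) (F : Set C(Ω, 𝕜)) (m : ℕ) :
    ℝ≥0∞ :=
  ⨅ (x : Finset Ω) (_ : x.card ≤ m) (T : (x → 𝕜) →ₗ[𝕜] (Ω → 𝕜)) (_ : ∀ y, MemOrlicz Φ μ (T y)),
    ⨆ f ∈ F, luxNorm Φ μ (⇑f - T (fun i => f i))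

end Space

section Uniform

variable {𝕜 Ω : Type*} [RCLike 𝕜] [TopologicalSpace Ω] [CompactSpace Ω]

/-- The error `d(f, X)_∞` of best uniform approximation of `f` by elements of `X`. -/
noncomputable def uniformDist (f : C(Ω, 𝕜)) (X : Submodule 𝕜 C(Ω, 𝕜)) : ℝ≥0∞ :=
  ⨅ u ∈ X, ‖f - u‖ₑ

/-- The Kolmogorov width `d_N(F, ‖·‖_∞)`. The infimum is over the subspaces of dimension at most
`N`; it is the same as over those of dimension exactly `N` whenever there are any. -/
noncomputable def kolmogorovWidth (F : Set C(Ω, 𝕜)) (N : ℕ) : ℝ≥0∞ :=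
  ⨅ (X : Submodule 𝕜 C(Ω, 𝕜)) (_ : FiniteDimensional 𝕜 X ∧ Module.finrank 𝕜 X ≤ N),
    ⨆ f ∈ F, uniformDist f X

/-- `T` assigns to every vector `y` of samples at the points `x_1, …, x_k` (which may repeat) the
unique element of `X` that minimizes `∑_j |y_j - u(x_j)|²` over `u ∈ X`. -/
def IsLeastSquares (X : Submodule 𝕜 C(Ω, 𝕜)) {k : ℕ} (x : Fin k → Ω)
    (T : (Fin k → 𝕜) →ₗ[𝕜] C(Ω, 𝕜)) : Prop :=
  ∀ y : Fin k → 𝕜, T y ∈ X ∧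
    ∀ v ∈ X, v ≠ T y → ∑ j, ‖y j - T y (x j)‖ ^ 2 < ∑ j, ‖y j - v (x j)‖ ^ 2

/-- For some `k ≤ m` and some points `x_1, …, x_k`, least squares on `X` at these points is a linear
recovery method whose error in `L^Φ(μ)` is at most `B · d(f, X)_∞` for every continuous `f`. -/
def LeastSquaresRecovers [MeasurableSpace Ω] (Φ : ℝ≥0 → ℝ≥0) (μ : Measure Ω)
    (X : Submodule 𝕜 C(Ω, 𝕜)) (m : ℕ) (B : ℝ≥0) : Prop :=
  ∃ k ≤ m, ∃ (x : Fin k → Ω) (T : (Fin k → 𝕜) →ₗ[𝕜] C(Ω, 𝕜)), IsLeastSquares X x T ∧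
    ∀ f : C(Ω, 𝕜), luxNorm Φ μ (⇑f - ⇑(T fun j => f (x j))) ≤ B * uniformDist f X

end Uniform

/-- The factor `(Φ(√N) / N)^{1/p}`. -/
noncomputable def rate (Φ : ℝ≥0 → ℝ≥0) (p : ℝ) (N : ℕ) : ℝ≥0 :=
  (Φ (NNReal.sqrt N) / N) ^ (1 / p)

end Orlicz

/-!
Sampling on `X` is discretized as follows. Average the Gram matrix of `μ` on `X` with a `D`-optimal
information matrix: by the Kiefer–Wolfowitz argument, maximality of the determinant gives
`‖u‖_∞² ≤ N · A(u)` for the form `A` of the latter. The lower barrier argument of Batson, Spielman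
and Srivastava, with points repeated instead of weighted, then selects `6 N` points whose sampled
form `∑ⱼ |u(xⱼ)|²` dominates `N` times this average. It therefore controls both `‖u‖_∞²` and
`N ‖u‖²_{L²(μ)}`, so that the least squares approximation of `f` differs from any `u ∈ X` with
`‖f - u‖_∞ ≤ e` by a function which is at most of order `√N e` uniformly and of order `e` in
`L²(μ)`. Since `Φ(t) t⁻ᵖ`, and hence `Φ(t) t⁻²`, almost increases, `Φ(t) ≲ t² Φ(√N) / N` for
`t ≤ √N`, which for `e = 1` bounds the modular of this function by a multiple of `Φ(√N) / N`; the
growth of order `p` turns a factor in the modular into its power `1 / p` in the norm.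
-/

namespace Orlicz

open Matrix
open scoped ComplexOrder MatrixOrder

section RankOneUpdate

variable {R K ι : Type*} [CommRing R] [Field K] [Fintype ι]

lemma trace_mul_vecMulVec (Q : Matrix ι ι R) (s r : ι → R) :
    (Q * vecMulVec s r).trace = r ⬝ᵥ Q *ᵥ s := by
  rw [mul_vecMulVec, trace_vecMulVec, dotProduct_comm]

lemma replicateRow_mul_mul_replicateCol (A : Matrix ι ι R) (r s : ι → R) :
    replicateRow Unit r * A * replicateCol Unit s = diagonal fun _ => r ⬝ᵥ A *ᵥ s := by
  rw [Matrix.mul_assoc, ← replicateCol_mulVec]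
  ext
  simp

variable [DecidableEq ι]

lemma det_add_vecMulVec {A : Matrix ι ι R} (hA : IsUnit A.det) (s r : ι → R) :
    (A + vecMulVec s r).det = A.det * (1 + r ⬝ᵥ A⁻¹ *ᵥ s) := by
  rw [vecMulVec_eq Unit, det_add_replicateCol_mul_replicateRow hA,
    replicateRow_mul_mul_replicateCol, ← diagonal_one, diagonal_add, det_diagonal]
  simp

lemma trace_inv_add_vecMulVec {M : Matrix ι ι K} (hM : IsUnit M) {s r : ι → K}
    (h : 1 + r ⬝ᵥ M⁻¹ *ᵥ s ≠ 0) :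
    (M + vecMulVec s r)⁻¹.trace =
      M⁻¹.trace - (r ⬝ᵥ (M⁻¹ * M⁻¹) *ᵥ s) / (1 + r ⬝ᵥ M⁻¹ *ᵥ s) := by
  set U := replicateCol Unit s
  set V := replicateRow Unit r
  set D : Matrix Unit Unit K := diagonal fun _ => 1 + r ⬝ᵥ M⁻¹ *ᵥ s with hD
  have hcap : (1 : Matrix Unit Unit K)⁻¹ + V * M⁻¹ * U = D := by
    rw [replicateRow_mul_mul_replicateCol, inv_one, ← diagonal_one, diagonal_add]
  have hWoodbury := add_mul_mul_inv_eq_sub M U 1 V hM isUnit_one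
    (by rw [hcap, isUnit_diagonal]; exact Pi.isUnit_iff.2 fun _ => h.isUnit)
  rw [Matrix.mul_one, ← vecMulVec_eq, hcap] at hWoodbury
  calc (M + vecMulVec s r)⁻¹.trace = M⁻¹.trace - (M⁻¹ * (U * D⁻¹ * V * M⁻¹)).trace := by
        rw [hWoodbury, trace_sub]
        simp only [Matrix.mul_assoc]
    _ = M⁻¹.trace - (D⁻¹ * (V * (M⁻¹ * M⁻¹) * U)).trace := by
        rw [trace_mul_comm]
        simp only [Matrix.mul_assoc]
        rw [trace_mul_comm U]
        simp only [Matrix.mul_assoc]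
    _ = _ := by
        rw [replicateRow_mul_mul_replicateCol, inv_subsingleton D, hD, diagonal_mul_diagonal]
        simp [div_eq_inv_mul]

end RankOneUpdate

section Trace

variable {𝕜 ι : Type*} [RCLike 𝕜] [Fintype ι]

lemma re_trace_nonneg {A : Matrix ι ι 𝕜} (hA : A.PosSemidef) : 0 ≤ RCLike.re A.trace :=
  (RCLike.nonneg_iff.1 hA.trace_nonneg).1

lemma re_trace_mul_nonneg {A B : Matrix ι ι 𝕜} (hA : A.PosSemidef) (hB : B.PosSemidef) :
    0 ≤ RCLike.re (A * B).trace := by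
  classical
  obtain ⟨C, rfl⟩ := CStarAlgebra.nonneg_iff_eq_star_mul_self.1 hA.nonneg
  rw [Matrix.mul_assoc, trace_mul_comm]
  exact re_trace_nonneg (hB.mul_mul_conjTranspose_same C)

variable [DecidableEq ι]

lemma posSemidef_one_sub_of_re_trace_le_one {Q : Matrix ι ι 𝕜} (hQ : Q.PosSemidef)
    (h : RCLike.re Q.trace ≤ 1) : (1 - Q).PosSemidef := by
  rw [hQ.1.trace_eq_sum_eigenvalues, ← RCLike.ofReal_sum, RCLike.ofReal_re] at h
  have hle : Q ≤ algebraMap ℝ (Matrix ι ι 𝕜) 1 := by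
    refine le_algebraMap_of_spectrum_le (fun t ht => ?_) hQ.1
    rw [hQ.1.spectrum_real_eq_range_eigenvalues] at ht
    obtain ⟨i, rfl⟩ := ht
    exact (Finset.single_le_sum (fun j _ => hQ.eigenvalues_nonneg j) (Finset.mem_univ i)).trans h
  simpa only [map_one, le_iff] using hle

section Shift

variable {P : Matrix ι ι 𝕜} {t : ℝ}

lemma posDef_sub_smul_one (hP : P.PosDef) (hP1 : (1 - P⁻¹).PosSemidef) (ht : t < 1) :
    (P - t • (1 : Matrix ι ι 𝕜)).PosDef := by
  have hdet : IsUnit P.det := (isUnit_iff_isUnit_det P).1 hP.isUnit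
  have hconj : ((P - 1)ᴴ * P⁻¹ * (P - 1)).PosSemidef :=
    hP.inv.posSemidef.conjTranspose_mul_mul_same _
  have hsplit : P - t • (1 : Matrix ι ι 𝕜) =
      (P - 1)ᴴ * P⁻¹ * (P - 1) + (1 - P⁻¹) + (1 - t) • (1 : Matrix ι ι 𝕜) := by
    rw [conjTranspose_sub, hP.1.eq, conjTranspose_one, Matrix.sub_mul, Matrix.one_mul,
      mul_nonsing_inv _ hdet, Matrix.sub_mul, Matrix.mul_sub, Matrix.mul_sub,
      nonsing_inv_mul _ hdet, sub_smul, one_smul]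
    noncomm_ring
  rw [hsplit]
  exact ((PosDef.one).smul (sub_pos.2 ht)).posSemidef_add (hconj.add hP1)

lemma inv_sub_smul_one_sub_inv (hP : IsUnit P) (hM : IsUnit (P - t • (1 : Matrix ι ι 𝕜))) :
    (P - t • (1 : Matrix ι ι 𝕜))⁻¹ - P⁻¹ = t • ((P - t • (1 : Matrix ι ι 𝕜))⁻¹ * P⁻¹) := by
  rw [Matrix.inv_sub_inv (by simp [hP, hM]), sub_sub_cancel, Matrix.mul_smul, Matrix.mul_one,
    Matrix.smul_mul]

lemma re_trace_inv_sub_smul_one_le (hP : P.PosDef) (hP1 : (1 - P⁻¹).PosSemidef) (ht0 : 0 ≤ t)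
    (ht : t < 1) :
    (1 - t) * RCLike.re (P - t • (1 : Matrix ι ι 𝕜))⁻¹.trace ≤ RCLike.re P⁻¹.trace := by
  have hM := posDef_sub_smul_one hP hP1 ht
  have hres := congrArg (fun A => RCLike.re A.trace)
    (inv_sub_smul_one_sub_inv hP.isUnit hM.isUnit)
  set M := P - t • (1 : Matrix ι ι 𝕜)
  have hpos := re_trace_mul_nonneg hM.inv.posSemidef hP1
  simp only [trace_sub, trace_smul, map_sub, RCLike.smul_re, Matrix.mul_sub, Matrix.mul_one]
    at hres hpos
  nlinarith

lemma re_trace_inv_sub_smul_one_sub_le (hP : P.PosDef) (hP1 : (1 - P⁻¹).PosSemidef)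
    (ht0 : 0 ≤ t) (ht : t < 1) :
    RCLike.re (P - t • (1 : Matrix ι ι 𝕜))⁻¹.trace - RCLike.re P⁻¹.trace ≤
      t * RCLike.re ((P - t • (1 : Matrix ι ι 𝕜))⁻¹ * (P - t • (1 : Matrix ι ι 𝕜))⁻¹).trace := by
  have hM := posDef_sub_smul_one hP hP1 ht
  have hres := inv_sub_smul_one_sub_inv hP.isUnit hM.isUnit
  set M := P - t • (1 : Matrix ι ι 𝕜)
  have hsq : RCLike.re (M⁻¹ * P⁻¹).trace ≤ RCLike.re (M⁻¹ * M⁻¹).trace := by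
    rw [← sub_nonneg, ← map_sub, ← trace_sub, ← Matrix.mul_sub, hres, Matrix.mul_smul, trace_smul,
      RCLike.smul_re, ← Matrix.mul_assoc]
    have hMM : (M⁻¹ * M⁻¹).PosSemidef := by simpa only [sq] using hM.inv.posSemidef.pow 2
    exact mul_nonneg ht0 (re_trace_mul_nonneg hMM hP.inv.posSemidef)
  rw [← map_sub, ← trace_sub, hres, trace_smul, RCLike.smul_re]
  exact mul_le_mul_of_nonneg_left hsq ht0

end Shift

end Trace

section HermitianForm

variable {𝕜 ι : Type*} [RCLike 𝕜] [Fintype ι]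

/-- The value `c* A c` of the Hermitian form of `A` at `c`, as a linear functional of `A`. -/
noncomputable def formAt (c : ι → 𝕜) : Matrix ι ι 𝕜 →ₗ[ℝ] ℝ where
  toFun A := RCLike.re (star c ⬝ᵥ A *ᵥ c)
  map_add' A B := by rw [add_mulVec, dotProduct_add, map_add]
  map_smul' t A := by
    rw [smul_mulVec, dotProduct_smul, RCLike.smul_re, RingHom.id_apply, smul_eq_mul]

lemma formAt_nonneg {A : Matrix ι ι 𝕜} (hA : A.PosSemidef) (c : ι → 𝕜) : 0 ≤ formAt c A :=
  hA.re_dotProduct_nonneg c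

lemma formAt_vecMulVec (c v : ι → 𝕜) : formAt c (vecMulVec (star v) v) = ‖v ⬝ᵥ c‖ ^ 2 := by
  change RCLike.re (star c ⬝ᵥ vecMulVec (star v) v *ᵥ c) = _
  rw [vecMulVec_mulVec, dotProduct_smul, star_dotProduct_star, MulOpposite.smul_eq_mul_unop]
  rw [MulOpposite.unop_op, RCLike.star_def, RCLike.conj_mul, ← RCLike.ofReal_pow,
    RCLike.ofReal_re]

lemma formAt_conjTranspose_mul_mul_same (A B : Matrix ι ι 𝕜) (c : ι → 𝕜) :
    formAt c (Bᴴ * A * B) = formAt (B *ᵥ c) A := by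
  change RCLike.re (star c ⬝ᵥ (Bᴴ * A * B) *ᵥ c) = RCLike.re (star (B *ᵥ c) ⬝ᵥ A *ᵥ B *ᵥ c)
  rw [star_mulVec, ← dotProduct_mulVec, mulVec_mulVec, mulVec_mulVec, Matrix.mul_assoc]

end HermitianForm

section InformationMatrices

variable {𝕜 ι Ω : Type*} [RCLike 𝕜]

/-- The information matrices of experimental design theory: the closed convex hull of the rank one
matrices `r(x)* r(x)`. It contains the Gram matrices of the coordinates of `r` with respect to all
probability measures on `Ω`. -/
def informationMatrices (r : Ω → ι → 𝕜) : Set (Matrix ι ι 𝕜) :=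
  closedConvexHull ℝ (Set.range fun x => vecMulVec (star (r x)) (r x))

variable {r : Ω → ι → 𝕜} {M : Matrix ι ι 𝕜}

lemma vecMulVec_mem_informationMatrices (r : Ω → ι → 𝕜) (x : Ω) :
    vecMulVec (star (r x)) (r x) ∈ informationMatrices r :=
  subset_closedConvexHull ⟨x, rfl⟩

lemma informationMatrices_subset {K : Set (Matrix ι ι 𝕜)} (hconv : Convex ℝ K)
    (hclosed : IsClosed K) (h : ∀ x, vecMulVec (star (r x)) (r x) ∈ K) :
    informationMatrices r ⊆ K :=
  closedConvexHull_min (Set.range_subset_iff.2 h) hconv hclosed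

lemma convex_informationMatrices (r : Ω → ι → 𝕜) : Convex ℝ (informationMatrices r) :=
  convex_closedConvexHull

lemma isClosed_informationMatrices (r : Ω → ι → 𝕜) : IsClosed (informationMatrices r) :=
  isClosed_closedConvexHull

lemma midpoint_mem_informationMatrices {A B : Matrix ι ι 𝕜} (hA : A ∈ informationMatrices r)
    (hB : B ∈ informationMatrices r) :
    (1 / 2 : ℝ) • A + (1 / 2 : ℝ) • B ∈ informationMatrices r :=
  convex_informationMatrices r hA hB (by norm_num) (by norm_num) (by norm_num)

lemma posSemidef_of_mem_informationMatrices [Finite ι] (hM : M ∈ informationMatrices r) :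
    M.PosSemidef := by
  cases nonempty_fintype ι
  refine informationMatrices_subset (K := {A | A.PosSemidef})
    (fun A hA B hB s t hs ht _ => (hA.smul hs).add (hB.smul ht)) ?_
    (fun x => posSemidef_vecMulVec_star_self (r x)) hM
  simp only [posSemidef_iff_dotProduct_mulVec, IsHermitian, Set.ofPred_and, Set.ofPred_forall]
  refine (isClosed_eq (by fun_prop) continuous_id).inter (isClosed_iInter fun c => ?_)
  exact isClosed_le continuous_const (by fun_prop)

lemma conj_mem_informationMatrices [Fintype ι] (hM : M ∈ informationMatrices r)
    (B : Matrix ι ι 𝕜) : Bᴴ * M * B ∈ informationMatrices fun x => r x ᵥ* B := by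
  let conj : Matrix ι ι 𝕜 →ₗ[ℝ] Matrix ι ι 𝕜 := LinearMap.mulRight ℝ B ∘ₗ LinearMap.mulLeft ℝ Bᴴ
  refine informationMatrices_subset ((convex_informationMatrices _).linear_preimage conj)
    ((isClosed_informationMatrices _).preimage conj.continuous_of_finiteDimensional)
    (fun x => ?_) hM
  have hconj : conj (vecMulVec (star (r x)) (r x)) =
      vecMulVec (star (r x ᵥ* B)) (r x ᵥ* B) := by
    simp only [conj, LinearMap.comp_apply, LinearMap.mulLeft_apply, LinearMap.mulRight_apply,
      mul_vecMulVec, vecMulVec_mul, star_vecMul]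
  rw [Set.mem_preimage, hconj]
  exact vecMulVec_mem_informationMatrices _ x

variable [TopologicalSpace Ω] [CompactSpace Ω]

lemma exists_le_apply_vecMulVec [Finite ι] (hr : Continuous r)
    (hM : M ∈ informationMatrices r) (L : Matrix ι ι 𝕜 →ₗ[ℝ] ℝ) :
    ∃ x, L M ≤ L (vecMulVec (star (r x)) (r x)) := by
  have hL : Continuous L := L.continuous_of_finiteDimensional
  cases isEmpty_or_nonempty Ω
  · exact (informationMatrices_subset convex_empty isClosed_empty isEmptyElim hM).elim
  · obtain ⟨x, -, hx⟩ := isCompact_univ.exists_isMaxOn Set.univ_nonempty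
      (hL.comp (hr.star.matrix_vecMulVec hr)).continuousOn
    exact ⟨x, informationMatrices_subset (convex_halfSpace_le L.isLinear _)
      (isClosed_le hL continuous_const) (fun y => hx (Set.mem_univ y)) hM⟩

open scoped Matrix.Norms.Elementwise in
lemma isCompact_informationMatrices [Finite ι] (hr : Continuous r) :
    IsCompact (informationMatrices r) := by
  cases nonempty_fintype ι
  have : ProperSpace (Matrix ι ι 𝕜) := FiniteDimensional.proper ℝ _
  refine Metric.isCompact_of_isClosed_isBounded (isClosed_informationMatrices r) ?_
  rw [informationMatrices, closedConvexHull_eq_closure_convexHull]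
  exact (isBounded_convexHull.2
    (isCompact_range (hr.star.matrix_vecMulVec hr)).isBounded).closure

lemma exists_formAt_eq_integral [Fintype ι] [MeasurableSpace Ω] [OpensMeasurableSpace Ω]
    (hr : Continuous r) (μ : Measure Ω) [IsProbabilityMeasure μ] :
    ∃ G ∈ informationMatrices r, ∀ c, formAt c G = ∫ x, ‖r x ⬝ᵥ c‖ ^ 2 ∂μ := by
  -- Matrices carry no global norm, so the integral is taken in the space of functions.
  let R : Ω → ι → ι → 𝕜 := fun x => vecMulVec (star (r x)) (r x)
  have hint : Integrable R μ :=
    Continuous.integrable_of_hasCompactSupport (hr.star.matrix_vecMulVec hr) (.of_compactSpace _)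
  let G : ι → ι → 𝕜 := ∫ x, R x ∂μ
  refine ⟨G, Convex.integral_mem (E := ι → ι → 𝕜) (convex_informationMatrices r)
    (isClosed_informationMatrices r)
    (.of_forall (vecMulVec_mem_informationMatrices r)) hint, fun c => ?_⟩
  let L : (ι → ι → 𝕜) →ₗ[ℝ] ℝ := formAt c
  calc formAt c G = ∫ x, L (R x) ∂μ :=
        (L.toContinuousLinearMap.integral_comp_comm hint).symm
    _ = ∫ x, ‖r x ⬝ᵥ c‖ ^ 2 ∂μ := integral_congr_ae (.of_forall fun x => formAt_vecMulVec c (r x))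

end InformationMatrices

section OptimalDesign

lemma le_natCast_of_one_add_mul_le_pow {h : ℝ} {n : ℕ}
    (hle : ∀ s : ℝ, 0 < s → 1 + s * h ≤ (1 + s) ^ n) : h ≤ n := by
  have hderiv : HasDerivAt (fun s : ℝ => (1 + s) ^ n) n 0 := by
    simpa using ((hasDerivAt_id (0 : ℝ)).const_add 1).fun_pow n
  refine ge_of_tendsto (hderiv.tendsto_slope.mono_left (nhdsGT_le_nhdsNE 0)) ?_
  filter_upwards [self_mem_nhdsWithin] with s (hs : 0 < s)
  rw [slope_def_field, sub_zero, add_zero, one_pow, le_div_iff₀ hs]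
  linarith [hle s hs]

variable {𝕜 ι Ω : Type*} [RCLike 𝕜] [Fintype ι]

lemma formAt_eq_zero_iff {A : Matrix ι ι 𝕜} (hA : A.PosSemidef) {c : ι → 𝕜} :
    formAt c A = 0 ↔ A *ᵥ c = 0 := by
  rw [← hA.dotProduct_mulVec_zero_iff]
  refine ⟨fun h => RCLike.ext (h.trans (map_zero _).symm) ?_, fun h => ?_⟩
  · rw [(RCLike.nonneg_iff.1 (hA.dotProduct_mulVec_nonneg c)).2, map_zero]
  · exact (congrArg RCLike.re h).trans (map_zero _)

lemma norm_dotProduct_mulVec_sq_le {A : Matrix ι ι 𝕜} (hA : A.PosSemidef) (b c : ι → 𝕜) :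
    ‖star b ⬝ᵥ A *ᵥ c‖ ^ 2 ≤ formAt b A * formAt c A := by
  let := A.toSeminormedAddCommGroup hA
  let := A.toInnerProductSpace hA
  have hinner (v w : ι → 𝕜) : inner 𝕜 v w = star v ⬝ᵥ A *ᵥ w := dotProduct_comm _ _
  have hCS := inner_mul_inner_self_le (𝕜 := 𝕜) b c
  rw [norm_inner_symm c b, hinner, hinner, hinner, ← sq] at hCS
  exact hCS

lemma norm_dotProduct_sq_le [DecidableEq ι] {A : Matrix ι ι 𝕜} (hA : A.PosDef) (v c : ι → 𝕜) :
    ‖v ⬝ᵥ c‖ ^ 2 ≤ RCLike.re (v ⬝ᵥ A⁻¹ *ᵥ star v) * formAt c A := by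
  have hdet : IsUnit A.det := (isUnit_iff_isUnit_det A).1 hA.isUnit
  have hstar : star (A⁻¹ *ᵥ star v) = v ᵥ* A⁻¹ := by rw [star_mulVec, star_star, hA.inv.1.eq]
  have hCS := norm_dotProduct_mulVec_sq_le hA.posSemidef (A⁻¹ *ᵥ star v) c
  rw [hstar, ← dotProduct_mulVec, mulVec_mulVec, nonsing_inv_mul _ hdet, one_mulVec] at hCS
  refine hCS.trans_eq (congrArg (RCLike.re · * _) ?_)
  rw [hstar, mulVec_mulVec, mul_nonsing_inv _ hdet, one_mulVec, dotProduct_mulVec]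

variable {r : Ω → ι → 𝕜}

lemma exists_posDef_mem_informationMatrices [Nonempty Ω]
    (hr : ∀ c, (∀ x, r x ⬝ᵥ c = 0) → c = 0) : ∃ A ∈ informationMatrices r, A.PosDef := by
  classical
  obtain ⟨_, ⟨A, hA, rfl⟩, hmin⟩ := IsArtinian.set_has_minimal
    ((fun A => A.mulVecLin.ker) '' informationMatrices r)
    ⟨_, _, vecMulVec_mem_informationMatrices r (Classical.arbitrary Ω), rfl⟩
  have hApos := posSemidef_of_mem_informationMatrices hA
  refine ⟨A, hA, hApos.posDef_iff_isUnit.2 <| mulVec_injective_iff_isUnit.1 <|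
    (injective_iff_map_eq_zero A.mulVecLin).2 fun c hc => hr c fun x => ?_⟩
  set B := vecMulVec (star (r x)) (r x)
  have hBpos : B.PosSemidef := posSemidef_vecMulVec_star_self (r x)
  have hker : ∀ b, ((1 / 2 : ℝ) • A + (1 / 2 : ℝ) • B) *ᵥ b = 0 → A *ᵥ b = 0 ∧ B *ᵥ b = 0 := by
    intro b hb
    rw [← formAt_eq_zero_iff ((hApos.smul (by norm_num)).add (hBpos.smul (by norm_num))), map_add,
      map_smul, map_smul, smul_eq_mul, smul_eq_mul] at hb
    have hA0 := formAt_nonneg hApos b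
    have hB0 := formAt_nonneg hBpos b
    exact ⟨(formAt_eq_zero_iff hApos).1 (by linarith), (formAt_eq_zero_iff hBpos).1 (by linarith)⟩
  have hnlt := hmin _ ⟨_, midpoint_mem_informationMatrices hA
    (vecMulVec_mem_informationMatrices r x), rfl⟩
  have hle := not_lt_iff_le_imp_ge.1 hnlt fun b hb => (hker b hb).1
  have hform := (formAt_eq_zero_iff hBpos).2 (hker c (hle hc)).2
  rwa [formAt_vecMulVec, sq_eq_zero_iff, norm_eq_zero] at hform

lemma re_det_add_vecMulVec [DecidableEq ι] {A : Matrix ι ι 𝕜} (hA : A.PosDef) (s r : ι → 𝕜) :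
    RCLike.re (A + vecMulVec s r).det =
      RCLike.re A.det * (1 + RCLike.re (r ⬝ᵥ A⁻¹ *ᵥ s)) := by
  rw [det_add_vecMulVec ((isUnit_iff_isUnit_det A).1 hA.isUnit), RCLike.mul_re,
    (RCLike.pos_iff.1 hA.det_pos).2, zero_mul, sub_zero, map_add, RCLike.one_re]

lemma re_dotProduct_inv_mulVec_star_le_card [DecidableEq ι] {A : Matrix ι ι 𝕜}
    (hA : A ∈ informationMatrices r) (hpos : A.PosDef)
    (hmax : ∀ B ∈ informationMatrices r, RCLike.re B.det ≤ RCLike.re A.det) (x : Ω) :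
    RCLike.re (r x ⬝ᵥ A⁻¹ *ᵥ star (r x)) ≤ Fintype.card ι := by
  refine le_natCast_of_one_add_mul_le_pow fun s hs => ?_
  have hs1 : 0 < 1 + s := by linarith
  have hdet : 0 < RCLike.re A.det := (RCLike.pos_iff.1 hpos.det_pos).1
  have hmem : (1 + s)⁻¹ • (A + vecMulVec (s • star (r x)) (r x)) ∈ informationMatrices r := by
    rw [smul_add, smul_vecMulVec, smul_smul]
    exact convex_informationMatrices r hA (vecMulVec_mem_informationMatrices r x)
      (inv_nonneg.2 hs1.le) (mul_nonneg (inv_nonneg.2 hs1.le) hs.le) (by field_simp)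
  have hle := hmax _ hmem
  rw [det_smul_of_tower, RCLike.smul_re, re_det_add_vecMulVec hpos, mulVec_smul, dotProduct_smul,
    RCLike.smul_re, inv_pow, inv_mul_le_iff₀ (by positivity), mul_comm _ (RCLike.re A.det)] at hle
  exact le_of_mul_le_mul_left hle hdet

lemma exists_optimalDesign [TopologicalSpace Ω] [CompactSpace Ω] [Nonempty Ω] (hcont : Continuous r)
    (hr : ∀ c, (∀ x, r x ⬝ᵥ c = 0) → c = 0) :
    ∃ A ∈ informationMatrices r, A.PosDef ∧
      ∀ x c, ‖r x ⬝ᵥ c‖ ^ 2 ≤ Fintype.card ι * formAt c A := by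
  classical
  obtain ⟨A₀, hA₀, hpos₀⟩ := exists_posDef_mem_informationMatrices hr
  obtain ⟨A, hA, hmax⟩ := (isCompact_informationMatrices hcont).exists_isMaxOn ⟨A₀, hA₀⟩
    (f := fun A => RCLike.re A.det) (by fun_prop)
  have hdet : 0 < RCLike.re A.det := (RCLike.pos_iff.1 hpos₀.det_pos).1.trans_le (hmax hA₀)
  have hpos : A.PosDef := (posSemidef_of_mem_informationMatrices hA).posDef_iff_det_ne_zero.2
    fun h => by simp [h] at hdet
  refine ⟨A, hA, hpos, fun x c => (norm_dotProduct_sq_le hpos (r x) c).trans ?_⟩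
  exact mul_le_mul_of_nonneg_right
    (re_dotProduct_inv_mulVec_star_le_card hA hpos (fun B hB => hmax hB) x)
    (formAt_nonneg hpos.posSemidef c)

end OptimalDesign

section Barrier

variable {𝕜 ι : Type*} [RCLike 𝕜] [Fintype ι] [DecidableEq ι]

lemma re_trace_inv_add_vecMulVec_le {M : Matrix ι ι 𝕜} (hM : M.PosDef) (v : ι → 𝕜) {δ : ℝ}
    (hδ : δ * (1 + RCLike.re (M⁻¹ * vecMulVec (star v) v).trace) ≤
      RCLike.re (M⁻¹ * M⁻¹ * vecMulVec (star v) v).trace) :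
    RCLike.re (M + vecMulVec (star v) v)⁻¹.trace ≤ RCLike.re M⁻¹.trace - δ := by
  rw [trace_mul_vecMulVec, trace_mul_vecMulVec] at hδ
  have hnonneg : 0 ≤ v ⬝ᵥ M⁻¹ *ᵥ star v := by
    simpa only [star_star] using hM.inv.posSemidef.dotProduct_mulVec_nonneg (star v)
  obtain ⟨κ, hκ, hreal⟩ := RCLike.nonneg_iff_exists_ofReal.1 hnonneg
  rw [← hreal, RCLike.ofReal_re] at hδ
  have hden : (1 : 𝕜) + v ⬝ᵥ M⁻¹ *ᵥ star v = (1 + κ : ℝ) := by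
    rw [← hreal, RCLike.ofReal_add, RCLike.ofReal_one]
  have hpos : 0 < 1 + κ := by linarith
  rw [trace_inv_add_vecMulVec hM.isUnit, hden, map_sub, RCLike.div_re_ofReal]
  · exact sub_le_sub_left ((le_div_iff₀ hpos).2 hδ) _
  · rw [hden]
    exact RCLike.ofReal_ne_zero.2 hpos.ne'

variable {Ω : Type*} [TopologicalSpace Ω] [CompactSpace Ω] {r : Ω → ι → 𝕜}

lemma exists_barrier_step (hr : Continuous r) (h1 : 1 ∈ informationMatrices r)
    {P : Matrix ι ι 𝕜} (hP : P.PosDef) (htr : RCLike.re P⁻¹.trace ≤ 1) :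
    ∃ x, (P - (1 / 3 : ℝ) • (1 : Matrix ι ι 𝕜) + vecMulVec (star (r x)) (r x)).PosDef ∧
      RCLike.re (P - (1 / 3 : ℝ) • (1 : Matrix ι ι 𝕜) +
        vecMulVec (star (r x)) (r x))⁻¹.trace ≤ 1 := by
  have hP1 := posSemidef_one_sub_of_re_trace_le_one hP.inv.posSemidef htr
  have hM := posDef_sub_smul_one hP hP1 (by norm_num : (1 / 3 : ℝ) < 1)
  have hgrowth := re_trace_inv_sub_smul_one_le hP hP1 (t := 1 / 3) (by norm_num) (by norm_num)
  have hshift := re_trace_inv_sub_smul_one_sub_le hP hP1 (t := 1 / 3) (by norm_num) (by norm_num)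
  set M := P - (1 / 3 : ℝ) • (1 : Matrix ι ι 𝕜)
  set δ := RCLike.re M⁻¹.trace - RCLike.re P⁻¹.trace
  -- `δ (1 + tr (M⁻¹ A)) ≤ tr (M⁻² A)` holds on average over `r`, that is for `A = 1`.
  let L : Matrix ι ι 𝕜 →ₗ[ℝ] ℝ :=
    RCLike.reLm ∘ₗ traceLinearMap ι ℝ 𝕜 ∘ₗ LinearMap.mulLeft ℝ (M⁻¹ * M⁻¹ - δ • M⁻¹)
  have hL (A : Matrix ι ι 𝕜) :
      L A = RCLike.re (M⁻¹ * M⁻¹ * A).trace - δ * RCLike.re (M⁻¹ * A).trace := by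
    simp [L, Matrix.sub_mul, RCLike.smul_re]
  obtain ⟨x, hx⟩ := exists_le_apply_vecMulVec hr h1 L
  rw [hL, hL, Matrix.mul_one, Matrix.mul_one] at hx
  have hsq : 0 ≤ RCLike.re (M⁻¹ * M⁻¹).trace :=
    re_trace_mul_nonneg hM.inv.posSemidef hM.inv.posSemidef
  have htrM : 0 ≤ RCLike.re M⁻¹.trace := re_trace_nonneg hM.inv.posSemidef
  have havg : δ * (1 + RCLike.re M⁻¹.trace) ≤ RCLike.re (M⁻¹ * M⁻¹).trace := by
    rcases le_total 0 δ with _ | _ <;> nlinarith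
  refine ⟨x, hM.add_posSemidef (posSemidef_vecMulVec_star_self _), ?_⟩
  have hdrop := re_trace_inv_add_vecMulVec_le hM (r x) (δ := δ) (by linarith)
  linarith

lemma exists_barrier (hr : Continuous r) (h1 : 1 ∈ informationMatrices r) {N : ℕ} (hN : 1 ≤ N)
    (hι : Fintype.card ι ≤ N) (k : ℕ) :
    ∃ x : Fin k → Ω,
      ((N - k / 3 : ℝ) • (1 : Matrix ι ι 𝕜) +
        ∑ j, vecMulVec (star (r (x j))) (r (x j))).PosDef ∧
      RCLike.re ((N - k / 3 : ℝ) • (1 : Matrix ι ι 𝕜) +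
        ∑ j, vecMulVec (star (r (x j))) (r (x j)))⁻¹.trace ≤ 1 := by
  induction k with
  | zero =>
    have hN0 : (0 : ℝ) < N := Nat.cast_pos.2 hN
    have hinv : ((N : ℝ) • (1 : Matrix ι ι 𝕜))⁻¹ = (N : ℝ)⁻¹ • 1 :=
      inv_eq_right_inv (by rw [smul_mul_smul_comm, mul_inv_cancel₀ hN0.ne', one_smul, mul_one])
    simp only [Nat.cast_zero, zero_div, sub_zero, Finset.univ_eq_empty, Finset.sum_empty,
      add_zero, exists_const, hinv, trace_smul, trace_one, RCLike.smul_re, RCLike.natCast_re]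
    exact ⟨PosDef.one.smul hN0, inv_mul_le_one_of_le₀ (Nat.cast_le.2 hι) hN0.le⟩
  | succ k ih =>
    obtain ⟨x, hP, htr⟩ := ih
    obtain ⟨y, hy⟩ := exists_barrier_step hr h1 hP htr
    refine ⟨Fin.snoc x y, ?_⟩
    have hlevel : (N - (k + 1 : ℕ) / 3 : ℝ) = (N - k / 3 : ℝ) - 1 / 3 := by
      push_cast
      ring
    simpa only [Fin.sum_univ_castSucc, Fin.snoc_castSucc, Fin.snoc_last, hlevel, sub_smul,
      add_sub_right_comm, ← add_assoc] using hy

lemma exists_sum_norm_dotProduct_sq_ge_of_one_mem (hr : Continuous r)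
    (h1 : 1 ∈ informationMatrices r) {N : ℕ} (hN : 1 ≤ N) (hι : Fintype.card ι ≤ N) :
    ∃ x : Fin (6 * N) → Ω, ∀ c, N * formAt c 1 ≤ ∑ j, ‖r (x j) ⬝ᵥ c‖ ^ 2 := by
  obtain ⟨x, hP, -⟩ := exists_barrier hr h1 hN hι (6 * N)
  refine ⟨x, fun c => ?_⟩
  have hform := formAt_nonneg hP.posSemidef c
  simp only [map_add, map_smul, map_sum, formAt_vecMulVec, smul_eq_mul] at hform
  push_cast at hform
  linarith

end Barrier

lemma exists_sum_norm_dotProduct_sq_ge {𝕜 ι Ω : Type*} [RCLike 𝕜] [Fintype ι] [TopologicalSpace Ω]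
    [CompactSpace Ω] {r : Ω → ι → 𝕜} (hr : Continuous r) {M : Matrix ι ι 𝕜}
    (hM : M ∈ informationMatrices r) (hpos : M.PosDef) {N : ℕ} (hN : 1 ≤ N)
    (hι : Fintype.card ι ≤ N) :
    ∃ x : Fin (6 * N) → Ω, ∀ c, N * formAt c M ≤ ∑ j, ‖r (x j) ⬝ᵥ c‖ ^ 2 := by
  classical
  obtain ⟨B, hB, rfl⟩ :=
    CStarAlgebra.isStrictlyPositive_iff_eq_star_mul_self.1 hpos.isStrictlyPositive
  have hdet : IsUnit B.det := (isUnit_iff_isUnit_det B).1 hB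
  have hwhite : B⁻¹ᴴ * (Bᴴ * B) * B⁻¹ = 1 := by
    rw [Matrix.mul_assoc, Matrix.mul_assoc, mul_nonsing_inv _ hdet, Matrix.mul_one,
      ← conjTranspose_mul, mul_nonsing_inv _ hdet, conjTranspose_one]
  have h1 := conj_mem_informationMatrices hM B⁻¹
  rw [star_eq_conjTranspose, hwhite] at h1
  obtain ⟨x, hx⟩ := exists_sum_norm_dotProduct_sq_ge_of_one_mem
    (hr.matrix_vecMul continuous_const) h1 hN hι
  refine ⟨x, fun c => ?_⟩
  have hsum := hx (B *ᵥ c)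
  simpa only [← formAt_conjTranspose_mul_mul_same, Matrix.mul_one, ← dotProduct_mulVec,
    mulVec_mulVec, nonsing_inv_mul _ hdet, one_mulVec, star_eq_conjTranspose] using hsum

section Discretization

variable {𝕜 Ω : Type*} [RCLike 𝕜] [TopologicalSpace Ω] [CompactSpace Ω] [MeasurableSpace Ω]
  [OpensMeasurableSpace Ω] (μ : Measure Ω) [IsProbabilityMeasure μ]

lemma exists_discretization_dotProduct {ι : Type*} [Fintype ι] {r : Ω → ι → 𝕜}
    (hcont : Continuous r) (hr : ∀ c, (∀ x, r x ⬝ᵥ c = 0) → c = 0) {N : ℕ} (hN : 1 ≤ N)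
    (hι : Fintype.card ι ≤ N) :
    ∃ x : Fin (6 * N) → Ω, ∀ c, (∀ y, ‖r y ⬝ᵥ c‖ ^ 2 ≤ 2 * ∑ j, ‖r (x j) ⬝ᵥ c‖ ^ 2) ∧
      N * ∫ y, ‖r y ⬝ᵥ c‖ ^ 2 ∂μ ≤ 2 * ∑ j, ‖r (x j) ⬝ᵥ c‖ ^ 2 := by
  classical
  have : Nonempty Ω := nonempty_of_isProbabilityMeasure μ
  obtain ⟨A, hA, hApos, hsup⟩ := exists_optimalDesign hcont hr
  obtain ⟨G, hG, hint⟩ := exists_formAt_eq_integral hcont μ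
  have hGpos := posSemidef_of_mem_informationMatrices hG
  obtain ⟨x, hx⟩ := exists_sum_norm_dotProduct_sq_ge hcont (midpoint_mem_informationMatrices hA hG)
    ((hApos.smul (by norm_num)).add_posSemidef (hGpos.smul (by norm_num))) hN hι
  refine ⟨x, fun c => ?_⟩
  have hsum := hx c
  rw [map_add, map_smul, map_smul, smul_eq_mul, smul_eq_mul, mul_add] at hsum
  have hAc : 0 ≤ N * formAt c A := by have := formAt_nonneg hApos.posSemidef c; positivity
  have hGc : 0 ≤ N * formAt c G := by have := formAt_nonneg hGpos c; positivity
  refine ⟨fun y => ?_, ?_⟩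
  · have hcard : Fintype.card ι * formAt c A ≤ N * formAt c A :=
      mul_le_mul_of_nonneg_right (Nat.cast_le.2 hι) (formAt_nonneg hApos.posSemidef c)
    linarith [hsup y c]
  · rw [← hint]
    linarith

lemma exists_discretization (X : Submodule 𝕜 C(Ω, 𝕜)) [FiniteDimensional 𝕜 X] {N : ℕ}
    (hN : 1 ≤ N) (hX : Module.finrank 𝕜 X ≤ N) :
    ∃ x : Fin (6 * N) → Ω, ∀ u ∈ X, (∀ y, ‖u y‖ ^ 2 ≤ 2 * ∑ j, ‖u (x j)‖ ^ 2) ∧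
      N * ∫ y, ‖u y‖ ^ 2 ∂μ ≤ 2 * ∑ j, ‖u (x j)‖ ^ 2 := by
  let b := Module.finBasis 𝕜 X
  let r : Ω → Fin (Module.finrank 𝕜 X) → 𝕜 := fun y i => (b i : C(Ω, 𝕜)) y
  have heval (c y) : (b.equivFun.symm c : C(Ω, 𝕜)) y = r y ⬝ᵥ c := by
    simp [b.equivFun_symm_apply, r, dotProduct, mul_comm]
  have hr : ∀ c, (∀ y, r y ⬝ᵥ c = 0) → c = 0 := fun c hc =>
    b.equivFun.symm.map_eq_zero_iff.1 (Subtype.ext (ContinuousMap.ext fun y => by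
      rw [heval, hc]; rfl))
  obtain ⟨x, hx⟩ :=
    exists_discretization_dotProduct μ (r := r) (by fun_prop) hr hN (by simpa using hX)
  refine ⟨x, fun u hu => ?_⟩
  have hdisc := hx (b.equivFun ⟨u, hu⟩)
  simpa only [← heval, LinearEquiv.symm_apply_apply] using hdisc

end Discretization

section LeastSquares

lemma norm_sub_starProjection_sq_lt {𝕜 E : Type*} [RCLike 𝕜] [NormedAddCommGroup E]
    [InnerProductSpace 𝕜 E] (W : Submodule 𝕜 E) [W.HasOrthogonalProjection] (y : E) {w : E}
    (hw : w ∈ W) (hne : w ≠ W.starProjection y) :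
    ‖y - W.starProjection y‖ ^ 2 < ‖y - w‖ ^ 2 := by
  have hpyth := norm_add_sq_eq_norm_sq_add_norm_sq_of_inner_eq_zero (𝕜 := 𝕜) _ _
    (W.inner_left_of_mem_orthogonal (W.sub_mem (W.starProjection_apply_mem y) hw)
      (W.sub_starProjection_mem_orthogonal y))
  rw [sub_add_sub_cancel] at hpyth
  have hpos : 0 < ‖W.starProjection y - w‖ := norm_pos_iff.2 (sub_ne_zero.2 hne.symm)
  nlinarith

variable {𝕜 Ω : Type*} [RCLike 𝕜] [TopologicalSpace Ω] {k : ℕ}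
  {X : Submodule 𝕜 C(Ω, 𝕜)} {x : Fin k → Ω}

/-- The samples of a function at the points `x`, in the Euclidean norm that least squares
minimizes. -/
noncomputable def sample (x : Fin k → Ω) : C(Ω, 𝕜) →ₗ[𝕜] EuclideanSpace 𝕜 (Fin k) :=
  (WithLp.linearEquiv 2 𝕜 (Fin k → 𝕜)).symm.toLinearMap ∘ₗ
    LinearMap.pi fun j => (ContinuousMap.evalCLM 𝕜 (x j)).toLinearMap

lemma norm_sample_sq (x : Fin k → Ω) (u : C(Ω, 𝕜)) : ‖sample x u‖ ^ 2 = ∑ j, ‖u (x j)‖ ^ 2 :=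
  EuclideanSpace.norm_sq_eq _

lemma norm_toLp_sub_sample_sq (x : Fin k → Ω) (y : Fin k → 𝕜) (u : C(Ω, 𝕜)) :
    ‖WithLp.toLp 2 y - sample x u‖ ^ 2 = ∑ j, ‖y j - u (x j)‖ ^ 2 :=
  EuclideanSpace.norm_sq_eq _

lemma exists_isLeastSquares (hx : ∀ u ∈ X, (∀ j, u (x j) = 0) → u = 0) :
    ∃ T : (Fin k → 𝕜) →ₗ[𝕜] C(Ω, 𝕜), IsLeastSquares X x T ∧
      ∀ y, ∑ j, ‖T y (x j)‖ ^ 2 ≤ ∑ j, ‖y j‖ ^ 2 := by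
  let e : X →ₗ[𝕜] EuclideanSpace 𝕜 (Fin k) := sample x ∘ₗ X.subtype
  have he : Function.Injective e := fun u v huv => Subtype.ext <| sub_eq_zero.1 <|
    hx (u - v) (X.sub_mem u.2 v.2) fun j => sub_eq_zero.2 (congrArg (· j) huv)
  let T : (Fin k → 𝕜) →ₗ[𝕜] C(Ω, 𝕜) := X.subtype ∘ₗ
    (LinearEquiv.ofInjective e he).symm.toLinearMap ∘ₗ
      e.range.orthogonalProjectionOnto.toLinearMap ∘ₗ
        (WithLp.linearEquiv 2 𝕜 (Fin k → 𝕜)).symm.toLinearMap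
  have hTX (y) : T y ∈ X := Subtype.prop _
  have hT (y) : sample x (T y) = e.range.starProjection (WithLp.toLp 2 y) :=
    congrArg Subtype.val ((LinearEquiv.ofInjective e he).apply_symm_apply
      (e.range.orthogonalProjectionOnto (WithLp.toLp 2 y)))
  refine ⟨T, fun y => ⟨hTX y, fun v hv hne => ?_⟩, fun y => ?_⟩
  · rw [← norm_toLp_sub_sample_sq, ← norm_toLp_sub_sample_sq, hT]
    refine norm_sub_starProjection_sq_lt _ _ ⟨⟨v, hv⟩, rfl⟩ fun h => hne ?_
    exact congrArg Subtype.val (he (a₁ := ⟨v, hv⟩) (a₂ := ⟨T y, hTX y⟩) (h.trans (hT y).symm))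
  · rw [← norm_sample_sq, hT, ← EuclideanSpace.norm_sq_eq (WithLp.toLp 2 y)]
    gcongr
    exact e.range.norm_starProjection_apply_le _

lemma IsLeastSquares.apply_samples {T : (Fin k → 𝕜) →ₗ[𝕜] C(Ω, 𝕜)} (hT : IsLeastSquares X x T)
    {u : C(Ω, 𝕜)} (hu : u ∈ X) : (T fun j => u (x j)) = u := by
  by_contra hne
  have hlt := (hT fun j => u (x j)).2 u hu (Ne.symm hne)
  simp only [sub_self, norm_zero, ne_eq, OfNat.ofNat_ne_zero, not_false_eq_true, zero_pow,
    Finset.sum_const_zero] at hlt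
  exact hlt.not_ge (Finset.sum_nonneg fun _ _ => sq_nonneg _)

end LeastSquares

section Growth

variable {Φ : ℝ≥0 → ℝ≥0} {p : ℝ} {a : ℝ≥0}

lemma AIncWith.mono_exponent {q : ℝ} (h : AIncWith Φ p a) (hqp : q ≤ p) : AIncWith Φ q a := by
  refine ⟨h.1, fun s t hs hst => ?_⟩
  have hsplit {r : ℝ≥0} (hr : 0 < r) : Φ r / r ^ q = Φ r / r ^ p * r ^ (p - q) := by
    rw [NNReal.rpow_sub hr.ne', div_mul_div_cancel₀ (NNReal.rpow_pos hr).ne']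
  rw [hsplit hs, hsplit (hs.trans hst), ← mul_assoc]
  exact mul_le_mul' (h.2 s t hs hst) (NNReal.rpow_le_rpow hst.le (sub_nonneg.2 hqp))

lemma AIncWith.map_mul_le_of_pos (h : AIncWith Φ p a) {θ s : ℝ≥0} (hθ0 : 0 < θ) (hθ : θ ≤ 1)
    (hs : 0 < s) : Φ (θ * s) ≤ a * θ ^ p * Φ s := by
  rcases hθ.eq_or_lt with rfl | hlt
  · simpa using le_mul_of_one_le_left (zero_le (a := Φ s)) h.1
  · have hinc := h.2 (θ * s) s (mul_pos hθ0 hs) (mul_lt_of_lt_one_left hs hlt)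
    rw [div_le_iff₀ (NNReal.rpow_pos (mul_pos hθ0 hs)), NNReal.mul_rpow] at hinc
    refine hinc.trans_eq ?_
    have : s ^ p ≠ 0 := (NNReal.rpow_pos hs).ne'
    field_simp

lemma AIncWith.map_zero (h : AIncWith Φ p a) (hΦ : Monotone Φ) (hp : 0 < p) : Φ 0 = 0 := by
  have hlim : Tendsto (fun θ : ℝ≥0 => a * θ ^ p * Φ 1) (𝓝[>] 0) (𝓝 0) := by
    have hcont : Continuous fun θ : ℝ≥0 => a * θ ^ p * Φ 1 :=
      ((NNReal.continuous_rpow_const hp.le).const_mul a).mul_const _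
    exact (hcont.tendsto' 0 0 (by simp [hp.ne'])).mono_left nhdsWithin_le_nhds
  refine le_antisymm (ge_of_tendsto hlim ?_) zero_le
  filter_upwards [Ioc_mem_nhdsGT zero_lt_one] with θ hθ
  exact (hΦ zero_le).trans (h.map_mul_le_of_pos hθ.1 hθ.2 one_pos)

lemma AIncWith.map_mul_le (h : AIncWith Φ p a) (hΦ : Monotone Φ) (hp : 0 < p) {θ : ℝ≥0}
    (hθ : θ ≤ 1) (s : ℝ≥0) : Φ (θ * s) ≤ a * θ ^ p * Φ s := by
  rcases (zero_le (a := θ)).eq_or_lt with rfl | hθ0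
  · simp [h.map_zero hΦ hp]
  rcases (zero_le (a := s)).eq_or_lt with rfl | hs0
  · simp [h.map_zero hΦ hp]
  exact h.map_mul_le_of_pos hθ0 hθ hs0

/-- The factor by which the error of recovery in `L^Φ` exceeds the error of best uniform
approximation, up to a numerical and a quasi-triangle constant. -/
noncomputable def errorFactor (Φ : ℝ≥0 → ℝ≥0) (p : ℝ) (a : ℝ≥0) (N : ℕ) : ℝ≥0 :=
  a ^ (2 / p) * (1 + (Φ 1)⁻¹) ^ (1 / p) * rate Φ p N

lemma errorFactor_rpow (hp : p ≠ 0) (N : ℕ) :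
    errorFactor Φ p a N ^ p = a ^ 2 * (1 + (Φ 1)⁻¹) * (Φ (NNReal.sqrt N) / N) := by
  rw [errorFactor, rate, NNReal.mul_rpow, NNReal.mul_rpow, ← NNReal.rpow_mul, ← NNReal.rpow_mul,
    ← NNReal.rpow_mul, div_mul_cancel₀ _ hp, div_mul_cancel₀ _ hp, NNReal.rpow_one,
    NNReal.rpow_one, NNReal.rpow_two]

variable {N : ℕ}

lemma AIncWith.map_le_sq (h : AIncWith Φ p a) (hΦ : Monotone Φ) (hp : 2 ≤ p) (hN : 1 ≤ N)
    {s : ℝ≥0} (hs : s ^ 2 ≤ N) : Φ s ≤ a * (Φ (NNReal.sqrt N) / N) * s ^ 2 := by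
  have hsqrt : 0 < NNReal.sqrt N := NNReal.sqrt_pos.2 (Nat.cast_pos.2 hN)
  have hle : s / NNReal.sqrt N ≤ 1 := (div_le_one hsqrt).2 (NNReal.le_sqrt_iff_sq_le.2 hs)
  calc Φ s = Φ (s / NNReal.sqrt N * NNReal.sqrt N) := by rw [div_mul_cancel₀ _ hsqrt.ne']
    _ ≤ a * (s / NNReal.sqrt N) ^ (2 : ℝ) * Φ (NNReal.sqrt N) :=
        (h.mono_exponent hp).map_mul_le hΦ two_pos hle _
    _ = a * (Φ (NNReal.sqrt N) / N) * s ^ 2 := by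
        rw [NNReal.rpow_two, div_pow, NNReal.sq_sqrt]
        ring

lemma AIncWith.one_le_errorFactor (h : AIncWith Φ p a) (hΦ : Monotone Φ) (hp : 2 ≤ p)
    (hΦ1 : 0 < Φ 1) (hN : 1 ≤ N) : 1 ≤ errorFactor Φ p a N := by
  have hp0 : 0 < p := two_pos.trans_le hp
  have hone : Φ 1 ≤ a * (Φ (NNReal.sqrt N) / N) := by
    simpa using h.map_le_sq hΦ hp hN (s := 1) (by simpa using hN)
  rw [← NNReal.rpow_le_rpow_iff hp0, NNReal.one_rpow, errorFactor_rpow hp0.ne']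
  calc 1 = 1 * (Φ 1)⁻¹ * Φ 1 := by rw [one_mul, inv_mul_cancel₀ hΦ1.ne']
    _ ≤ a * (1 + (Φ 1)⁻¹) * (a * (Φ (NNReal.sqrt N) / N)) :=
        mul_le_mul' (mul_le_mul' h.1 le_add_self) hone
    _ = a ^ 2 * (1 + (Φ 1)⁻¹) * (Φ (NNReal.sqrt N) / N) := by ring

lemma AIncWith.map_div_errorFactor_le (h : AIncWith Φ p a) (hΦ : Monotone Φ) (hp : 2 ≤ p)
    (hΦ1 : 0 < Φ 1) (hN : 1 ≤ N) {s : ℝ≥0} (hs : s ^ 2 ≤ N) :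
    Φ (s / errorFactor Φ p a N) ≤ s ^ 2 := by
  have hp0 : 0 < p := two_pos.trans_le hp
  have hE := h.one_le_errorFactor hΦ hp hΦ1 hN
  have hEp : errorFactor Φ p a N ^ p ≠ 0 := (NNReal.rpow_pos (one_pos.trans_le hE)).ne'
  calc Φ (s / errorFactor Φ p a N) = Φ ((errorFactor Φ p a N)⁻¹ * s) := by rw [div_eq_inv_mul]
    _ ≤ a * (errorFactor Φ p a N)⁻¹ ^ p * Φ s :=
        h.map_mul_le hΦ hp0 (inv_le_one_of_one_le₀ hE) s
    _ ≤ a * (errorFactor Φ p a N)⁻¹ ^ p * (a * (Φ (NNReal.sqrt N) / N) * s ^ 2) :=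
        mul_le_mul_right (h.map_le_sq hΦ hp hN hs) _
    _ = (errorFactor Φ p a N ^ p)⁻¹ * (a ^ 2 * 1 * (Φ (NNReal.sqrt N) / N)) * s ^ 2 := by
        rw [NNReal.inv_rpow]
        ring
    _ ≤ (errorFactor Φ p a N ^ p)⁻¹ * errorFactor Φ p a N ^ p * s ^ 2 := by
        rw [errorFactor_rpow hp0.ne']
        gcongr
        exact le_self_add
    _ = s ^ 2 := by rw [inv_mul_cancel₀ hEp, one_mul]

end Growth

section Norm

variable {𝕜 Ω : Type*} [RCLike 𝕜] [MeasurableSpace Ω]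
  {Φ : ℝ≥0 → ℝ≥0} {p : ℝ} {a : ℝ≥0} {N : ℕ} {μ : Measure Ω}

lemma luxNorm_le {f : Ω → 𝕜} {l : ℝ≥0} (hl : 0 < l) (h : modular Φ μ f l ≤ 1) :
    luxNorm Φ μ f ≤ l :=
  iInf₂_le l ⟨hl, h⟩

lemma luxNorm_zero (hΦ : Φ 0 = 0) : luxNorm Φ μ (0 : Ω → 𝕜) = 0 := by
  refine le_antisymm (ENNReal.le_of_forall_pos_le_add fun ε hε _ => ?_) zero_le
  rw [zero_add]
  exact luxNorm_le hε (by simp [modular, hΦ])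

lemma AIncWith.luxNorm_le_of_lintegral_sq_le (h : AIncWith Φ p a) (hΦ : Monotone Φ) (hp : 2 ≤ p)
    (hΦ1 : 0 < Φ 1) (hN : 1 ≤ N) {f : Ω → 𝕜} {t : ℝ≥0} (hsup : ∀ x, ‖f x‖₊ ^ 2 ≤ N * t ^ 2)
    (hint : ∫⁻ x, ‖f x‖ₑ ^ 2 ∂μ ≤ (t : ℝ≥0∞) ^ 2) :
    luxNorm Φ μ f ≤ (errorFactor Φ p a N * t : ℝ≥0) := by
  rcases (zero_le (a := t)).eq_or_lt with rfl | ht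
  · have hf : f = 0 := funext fun x => by simpa using hsup x
    rw [hf, luxNorm_zero (h.map_zero hΦ (two_pos.trans_le hp))]
    exact zero_le
  have hE := h.one_le_errorFactor hΦ hp hΦ1 hN
  have hpt (x) : Φ (‖f x‖₊ / (errorFactor Φ p a N * t)) ≤ (t ^ 2)⁻¹ * ‖f x‖₊ ^ 2 := by
    rw [mul_comm, ← div_div, ← div_eq_inv_mul, ← div_pow]
    refine h.map_div_errorFactor_le hΦ hp hΦ1 hN ?_
    rw [div_pow]
    exact div_le_of_le_mul₀ zero_le zero_le (hsup x)
  have htinv : ((t ^ 2)⁻¹ : ℝ≥0) * (t : ℝ≥0∞) ^ 2 = 1 := by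
    rw [← ENNReal.coe_pow, ← ENNReal.coe_mul, inv_mul_cancel₀ (by positivity), ENNReal.coe_one]
  refine luxNorm_le (by positivity) ?_
  calc modular Φ μ f (errorFactor Φ p a N * t)
      ≤ ∫⁻ x, ((t ^ 2)⁻¹ : ℝ≥0) * ‖f x‖ₑ ^ 2 ∂μ :=
        lintegral_mono fun x => ENNReal.coe_le_coe.2 (hpt x)
    _ = ((t ^ 2)⁻¹ : ℝ≥0) * ∫⁻ x, ‖f x‖ₑ ^ 2 ∂μ := lintegral_const_mul' _ _ ENNReal.coe_ne_top
    _ ≤ ((t ^ 2)⁻¹ : ℝ≥0) * (t : ℝ≥0∞) ^ 2 := by gcongr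
    _ = 1 := htinv

lemma modular_add_le (hΦ : Monotone Φ) {f : Ω → 𝕜} (hf : AEStronglyMeasurable f μ) (g : Ω → 𝕜)
    (l : ℝ≥0) : modular Φ μ (f + g) (2 * l) ≤ modular Φ μ f l + modular Φ μ g l := by
  have hpt (x) : Φ (‖(f + g) x‖₊ / (2 * l)) ≤ Φ (‖f x‖₊ / l) + Φ (‖g x‖₊ / l) := by
    have hmax : ‖(f + g) x‖₊ / (2 * l) ≤ max (‖f x‖₊ / l) (‖g x‖₊ / l) := by
      rw [max_div_div_right zero_le, ← mul_div_mul_left _ l two_ne_zero, two_mul (max _ _)]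
      gcongr
      exact (nnnorm_add_le _ _).trans (add_le_add (le_max_left _ _) (le_max_right _ _))
    refine (hΦ hmax).trans ?_
    rw [hΦ.map_max]
    exact max_le le_self_add le_add_self
  have hmeas : AEMeasurable (fun x => (Φ (‖f x‖₊ / l) : ℝ≥0∞)) μ :=
    (hΦ.measurable.comp_aemeasurable (hf.nnnorm.aemeasurable.div_const l)).coe_nnreal_ennreal
  rw [modular, modular, modular, ← lintegral_add_left' hmeas]
  exact lintegral_mono fun x => ENNReal.coe_le_coe.2 (hpt x)

lemma AIncWith.modular_mul_le (h : AIncWith Φ 1 a) (hΦ : Monotone Φ) (f : Ω → 𝕜)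
    {l L : ℝ≥0} (hl : 0 < l) (hL : l ≤ L) :
    modular Φ μ f (2 * a * L) ≤ (2⁻¹ : ℝ≥0) * modular Φ μ f l := by
  have ha : 0 < a := one_pos.trans_le h.1
  have hle : (2 * a)⁻¹ ≤ 1 := inv_le_one_of_one_le₀ (one_le_mul one_le_two h.1)
  have hpt (x) : Φ (‖f x‖₊ / (2 * a * L)) ≤ 2⁻¹ * Φ (‖f x‖₊ / l) :=
    calc Φ (‖f x‖₊ / (2 * a * L)) ≤ Φ ((2 * a)⁻¹ * (‖f x‖₊ / l)) := by
          refine hΦ ?_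
          rw [← div_eq_inv_mul, div_div, mul_comm l]
          gcongr
      _ ≤ a * (2 * a)⁻¹ ^ (1 : ℝ) * Φ (‖f x‖₊ / l) := h.map_mul_le hΦ one_pos hle _
      _ = 2⁻¹ * Φ (‖f x‖₊ / l) := by
          rw [NNReal.rpow_one, _root_.mul_inv_rev, mul_inv_cancel_left₀ ha.ne']
  rw [modular, modular, ← lintegral_const_mul' _ _ ENNReal.coe_ne_top]
  exact lintegral_mono fun x => ENNReal.coe_le_coe.2 (hpt x)

lemma AIncWith.isQuasiTriangleConst (h : AIncWith Φ 1 a) (hΦ : Monotone Φ) :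
    IsQuasiTriangleConst 𝕜 Φ μ (4 * a) := by
  intro f g hf _
  have ha : 0 < a := one_pos.trans_le h.1
  have hadd (l₁ l₂ : ℝ≥0) (hl₁ : 0 < l₁ ∧ modular Φ μ f l₁ ≤ 1)
      (hl₂ : 0 < l₂ ∧ modular Φ μ g l₂ ≤ 1) :
      luxNorm Φ μ (f + g) ≤ (4 * a : ℝ≥0) * (l₁ + l₂ : ℝ≥0∞) := by
    have hl₁0 := hl₁.1
    rw [← ENNReal.coe_add, ← ENNReal.coe_mul]
    refine luxNorm_le (by positivity) ?_
    calc modular Φ μ (f + g) (4 * a * (l₁ + l₂))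
        = modular Φ μ (f + g) (2 * (2 * a * (l₁ + l₂))) := by ring_nf
      _ ≤ modular Φ μ f (2 * a * (l₁ + l₂)) + modular Φ μ g (2 * a * (l₁ + l₂)) :=
          modular_add_le hΦ hf.1 g _
      _ ≤ (2⁻¹ : ℝ≥0) * modular Φ μ f l₁ + (2⁻¹ : ℝ≥0) * modular Φ μ g l₂ :=
          add_le_add (h.modular_mul_le hΦ f hl₁.1 le_self_add)
            (h.modular_mul_le hΦ g hl₂.1 le_add_self)
      _ ≤ (2⁻¹ : ℝ≥0) * 1 + (2⁻¹ : ℝ≥0) * 1 := by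
          gcongr
          exacts [hl₁.2, hl₂.2]
      _ = 1 := by simp [ENNReal.inv_two_add_inv_two]
  have ha4 : ((4 * a : ℝ≥0) : ℝ≥0∞) ≠ 0 := by simpa using ha.ne'
  rw [luxNorm.eq_def Φ μ f, luxNorm.eq_def Φ μ g]
  simp only [ENNReal.iInf_add, ENNReal.add_iInf, ENNReal.mul_iInf_of_ne ha4 ENNReal.coe_ne_top]
  exact le_iInf₂ fun l₂ hl₂ => le_iInf₂ fun l₁ hl₁ => hadd l₁ l₂ hl₁ hl₂

end Norm

section Recovery

variable {𝕜 Ω : Type*} [RCLike 𝕜] [TopologicalSpace Ω] [CompactSpace Ω]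
  {Φ : ℝ≥0 → ℝ≥0} {p : ℝ} {a B K : ℝ≥0} {m N : ℕ}

lemma le_coe_mul_iInf₂ {ι : Type*} {q : ι → Prop} {c : ℝ≥0∞} {e : ι → ℝ≥0∞} (hq : ∃ i, q i)
    (h : ∀ i, q i → c ≤ B * e i) : c ≤ B * ⨅ (i) (_ : q i), e i := by
  rcases eq_or_ne B 0 with rfl | hB
  · obtain ⟨i, hi⟩ := hq
    simpa using h i hi
  · simpa only [ENNReal.mul_iInf_of_ne (ENNReal.coe_ne_zero.2 hB) ENNReal.coe_ne_top]
      using le_iInf₂ h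

variable [MeasurableSpace Ω] [OpensMeasurableSpace Ω] {μ : Measure Ω}

lemma memOrlicz_of_continuous [IsFiniteMeasure μ] (hΦ : Monotone Φ) (f : C(Ω, 𝕜)) :
    MemOrlicz Φ μ f := by
  refine ⟨f.continuous.aestronglyMeasurable, 1, one_pos, ?_⟩
  calc modular Φ μ f 1 ≤ ∫⁻ _, (Φ ‖f‖₊ : ℝ≥0∞) ∂μ := lintegral_mono fun x =>
        ENNReal.coe_le_coe.2 (hΦ ((div_one ‖f x‖₊).trans_le (f.norm_coe_le_norm x)))
    _ = Φ ‖f‖₊ * μ Set.univ := lintegral_const _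
    _ < ∞ := ENNReal.mul_lt_top ENNReal.coe_lt_top (measure_lt_top μ _)

section ErrorEstimates

variable [IsProbabilityMeasure μ] (h : AIncWith Φ p a) (hΦ : Monotone Φ) (hp : 2 ≤ p)
  (hΦ1 : 0 < Φ 1) (hN : 1 ≤ N)
include h hΦ hp hΦ1 hN

lemma AIncWith.luxNorm_le_of_integral_sq_le {f : C(Ω, 𝕜)} {t : ℝ≥0}
    (hsup : ∀ x, ‖f x‖ ^ 2 ≤ N * t ^ 2) (hint : ∫ x, ‖f x‖ ^ 2 ∂μ ≤ t ^ 2) :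
    luxNorm Φ μ f ≤ (errorFactor Φ p a N * t : ℝ≥0) := by
  refine h.luxNorm_le_of_lintegral_sq_le hΦ hp hΦ1 hN (fun x => by exact_mod_cast hsup x) ?_
  have hintegrable : Integrable (fun x => ‖f x‖ ^ 2) μ :=
    Continuous.integrable_of_hasCompactSupport (by fun_prop) (.of_compactSpace _)
  calc ∫⁻ x, ‖f x‖ₑ ^ 2 ∂μ = ENNReal.ofReal (∫ x, ‖f x‖ ^ 2 ∂μ) := by
        rw [ofReal_integral_eq_lintegral_ofReal hintegrable (ae_of_all _ fun _ => by positivity)]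
        simp only [ENNReal.ofReal_pow (norm_nonneg _), ofReal_norm]
    _ ≤ ENNReal.ofReal ((t : ℝ) ^ 2) := ENNReal.ofReal_le_ofReal hint
    _ = (t : ℝ≥0∞) ^ 2 := by
        rw [ENNReal.ofReal_pow (NNReal.coe_nonneg t), ENNReal.ofReal_coe_nnreal]

lemma AIncWith.luxNorm_le_nnnorm (f : C(Ω, 𝕜)) :
    luxNorm Φ μ f ≤ (errorFactor Φ p a N * ‖f‖₊ : ℝ≥0) := by
  have hle (x) : ‖f x‖ ^ 2 ≤ ‖f‖ ^ 2 := pow_le_pow_left₀ (norm_nonneg _) (f.norm_coe_le_norm x) 2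
  refine h.luxNorm_le_of_integral_sq_le hΦ hp hΦ1 hN (fun x => (hle x).trans ?_) ?_
  · exact le_mul_of_one_le_left (by positivity) (Nat.one_le_cast.2 hN)
  · calc ∫ x, ‖f x‖ ^ 2 ∂μ ≤ ∫ _, ‖f‖ ^ 2 ∂μ := integral_mono_of_nonneg
          (ae_of_all _ fun _ => by positivity) (integrable_const _) (ae_of_all _ hle)
      _ = ‖f‖ ^ 2 := by simp

lemma AIncWith.luxNorm_apply_samples_le {X : Submodule 𝕜 C(Ω, 𝕜)} {x : Fin (6 * N) → Ω}
    (hx : ∀ u ∈ X, (∀ y, ‖u y‖ ^ 2 ≤ 2 * ∑ j, ‖u (x j)‖ ^ 2) ∧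
      N * ∫ y, ‖u y‖ ^ 2 ∂μ ≤ 2 * ∑ j, ‖u (x j)‖ ^ 2)
    {T : (Fin (6 * N) → 𝕜) →ₗ[𝕜] C(Ω, 𝕜)} (hTX : ∀ y, T y ∈ X)
    (hT : ∀ y, ∑ j, ‖T y (x j)‖ ^ 2 ≤ ∑ j, ‖y j‖ ^ 2) (g : C(Ω, 𝕜)) :
    luxNorm Φ μ (T fun j => g (x j)) ≤ (errorFactor Φ p a N * (4 * ‖g‖₊) : ℝ≥0) := by
  obtain ⟨hsup, hint⟩ := hx _ (hTX fun j => g (x j))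
  have hsum : 2 * ∑ j, ‖T (fun j => g (x j)) (x j)‖ ^ 2 ≤ N * (4 * ‖g‖) ^ 2 :=
    calc 2 * ∑ j, ‖T (fun j => g (x j)) (x j)‖ ^ 2 ≤ 2 * ∑ j, ‖g (x j)‖ ^ 2 :=
          mul_le_mul_of_nonneg_left (hT _) zero_le_two
      _ ≤ 2 * ∑ _j : Fin (6 * N), ‖g‖ ^ 2 := by
          gcongr
          exact g.norm_coe_le_norm _
      _ = N * (12 * ‖g‖ ^ 2) := by
          simp only [Finset.sum_const, Finset.card_univ, Fintype.card_fin, nsmul_eq_mul,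
            Nat.cast_mul, Nat.cast_ofNat]
          ring
      _ ≤ N * (4 * ‖g‖) ^ 2 := by
          gcongr
          linarith [sq_nonneg ‖g‖]
  have hN0 : (0 : ℝ) < N := Nat.cast_pos.2 hN
  exact h.luxNorm_le_of_integral_sq_le hΦ hp hΦ1 hN (fun y => (hsup y).trans hsum)
    (le_of_mul_le_mul_left (hint.trans hsum) hN0)

lemma AIncWith.leastSquaresRecovers (hK : IsQuasiTriangleConst 𝕜 Φ μ K)
    (X : Submodule 𝕜 C(Ω, 𝕜)) [FiniteDimensional 𝕜 X] (hX : Module.finrank 𝕜 X ≤ N) :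
    LeastSquaresRecovers Φ μ X (6 * N) (5 * K * errorFactor Φ p a N) := by
  obtain ⟨x, hx⟩ := exists_discretization μ X hN hX
  have hinj : ∀ u ∈ X, (∀ j, u (x j) = 0) → u = 0 := fun u hu hzero =>
    ContinuousMap.ext fun y => by simpa [hzero, sq_nonpos_iff] using (hx u hu).1 y
  obtain ⟨T, hT, hTle⟩ := exists_isLeastSquares hinj
  refine ⟨6 * N, le_rfl, x, T, hT, fun f => le_coe_mul_iInf₂ ⟨0, X.zero_mem⟩ fun u hu => ?_⟩
  have herror : f - T (fun j => f (x j)) = (f - u) + T fun j => (u - f) (x j) := by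
    have hsub : (fun j => (u - f) (x j)) = (fun j => u (x j)) - fun j => f (x j) := rfl
    rw [hsub, map_sub, hT.apply_samples hu, sub_add_sub_cancel]
  calc luxNorm Φ μ (⇑f - ⇑(T fun j => f (x j)))
      = luxNorm Φ μ (⇑(f - u) + ⇑(T fun j => (u - f) (x j))) := by
        rw [← ContinuousMap.coe_sub, herror, ContinuousMap.coe_add]
    _ ≤ K * (luxNorm Φ μ ⇑(f - u) + luxNorm Φ μ ⇑(T fun j => (u - f) (x j))) :=
        hK _ _ (memOrlicz_of_continuous hΦ _) (memOrlicz_of_continuous hΦ _)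
    _ ≤ K * ((errorFactor Φ p a N * ‖f - u‖₊ : ℝ≥0) +
          (errorFactor Φ p a N * (4 * ‖u - f‖₊) : ℝ≥0)) := by
        gcongr
        · exact h.luxNorm_le_nnnorm hΦ hp hΦ1 hN _
        · exact h.luxNorm_apply_samples_le hΦ hp hΦ1 hN hx (fun y => (hT y).1) hTle _
    _ = (5 * K * errorFactor Φ p a N : ℝ≥0) * ‖f - u‖ₑ := by
        rw [← neg_sub f u, nnnorm_neg, enorm_eq_nnnorm]
        push_cast
        ring

end ErrorEstimates

lemma LeastSquaresRecovers.samplingNumber_le [IsFiniteMeasure μ] (hΦ : Monotone Φ)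
    {X : Submodule 𝕜 C(Ω, 𝕜)} (h : LeastSquaresRecovers Φ μ X m B) (F : Set C(Ω, 𝕜)) :
    samplingNumber Φ μ F m ≤ B * ⨆ f ∈ F, uniformDist f X := by
  classical
  obtain ⟨k, hk, x, T, -, hT⟩ := h
  let s : Finset Ω := Finset.univ.image x
  let S : (s → 𝕜) →ₗ[𝕜] (Ω → 𝕜) := ContinuousMap.coeFnLinearMap 𝕜 ∘ₗ T ∘ₗ
    LinearMap.funLeft 𝕜 𝕜 fun j => ⟨x j, Finset.mem_image_of_mem x (Finset.mem_univ j)⟩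
  have hcard : s.card ≤ m := (Finset.card_image_le.trans (by simp)).trans hk
  refine iInf₂_le_of_le s hcard (iInf₂_le_of_le S (fun y => memOrlicz_of_continuous hΦ _) ?_)
  simp only [ENNReal.mul_iSup]
  exact iSup₂_mono fun f _ => hT f

lemma AIncWith.samplingNumber_le [IsProbabilityMeasure μ] (h : AIncWith Φ p a) (hΦ : Monotone Φ)
    (hp : 2 ≤ p) (hΦ1 : 0 < Φ 1) (hN : 1 ≤ N) (hK : IsQuasiTriangleConst 𝕜 Φ μ K)
    (F : Set C(Ω, 𝕜)) :
    samplingNumber Φ μ F (6 * N) ≤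
      (5 * K * errorFactor Φ p a N : ℝ≥0) * kolmogorovWidth F N := by
  refine le_coe_mul_iInf₂ ⟨⊥, inferInstance, by simp⟩ fun X ⟨_, hX⟩ => ?_
  exact (h.leastSquaresRecovers hΦ hp hΦ1 hN hK X hX).samplingNumber_le hΦ F

lemma AIncWith.samplingNumber_le_and_leastSquaresRecovers [IsProbabilityMeasure μ]
    (h : AIncWith Φ p a) (hΦ : Monotone Φ) (hp : 2 ≤ p) (hΦ1 : 0 < Φ 1) (hN : 1 ≤ N)
    (hK : IsQuasiTriangleConst 𝕜 Φ μ K) :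
    (∀ F : Set C(Ω, 𝕜), samplingNumber Φ μ F (6 * N) ≤
      (5 * K * errorFactor Φ p a N : ℝ≥0) * kolmogorovWidth F N) ∧
    ∀ X : Submodule 𝕜 C(Ω, 𝕜), Module.finrank 𝕜 X = N →
      LeastSquaresRecovers Φ μ X (6 * N) (5 * K * errorFactor Φ p a N) := by
  refine ⟨h.samplingNumber_le hΦ hp hΦ1 hN hK, fun X hX => ?_⟩
  have : FiniteDimensional 𝕜 X := Module.finite_of_finrank_pos (hN.trans_eq hX.symm)
  exact h.leastSquaresRecovers hΦ hp hΦ1 hN hK X hX.le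

end Recovery

end Orlicz

theorem theorem6p1_general.{u, v} {p : ℝ} {Φ : ℝ≥0 → ℝ≥0} (hp : 2 ≤ p) (hΦ : Monotone Φ)
    (hap : Orlicz.AInc Φ p) (hΦ1 : 0 < Φ 1) :
    (∃ K : ℝ≥0, 1 ≤ K ∧
      ∀ (N : ℕ), 1 ≤ N →
      ∀ (𝕜 : Type u) [RCLike 𝕜] (Ω : Type v) [TopologicalSpace Ω] [CompactSpace Ω]
        [MeasurableSpace Ω] [OpensMeasurableSpace Ω] (μ : Measure Ω) [IsProbabilityMeasure μ],
        (∀ F : Set C(Ω, 𝕜),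
          Orlicz.samplingNumber Φ μ F (6 * N) ≤
            (K * Orlicz.rate Φ p N : ℝ≥0) * Orlicz.kolmogorovWidth F N) ∧
        (∀ X : Submodule 𝕜 C(Ω, 𝕜), Module.finrank 𝕜 X = N →
          Orlicz.LeastSquaresRecovers Φ μ X (6 * N) (K * Orlicz.rate Φ p N))) ∧
    (∀ a : ℝ≥0, Orlicz.AIncWith Φ p a →
      ∀ (N : ℕ), 1 ≤ N →
      ∀ (𝕜 : Type u) [RCLike 𝕜] (Ω : Type v) [TopologicalSpace Ω] [CompactSpace Ω]
        [MeasurableSpace Ω] [OpensMeasurableSpace Ω] (μ : Measure Ω) [IsProbabilityMeasure μ]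
        (CΦ : ℝ≥0), Orlicz.IsQuasiTriangleConst 𝕜 Φ μ CΦ →
        (∀ F : Set C(Ω, 𝕜),
          Orlicz.samplingNumber Φ μ F (6 * N) ≤
            (5 * CΦ * a ^ (2 / p) * (1 + (Φ 1)⁻¹) ^ (1 / p) * Orlicz.rate Φ p N : ℝ≥0) *
              Orlicz.kolmogorovWidth F N) ∧
        (∀ X : Submodule 𝕜 C(Ω, 𝕜), Module.finrank 𝕜 X = N →
          Orlicz.LeastSquaresRecovers Φ μ X (6 * N)
            (5 * CΦ * a ^ (2 / p) * (1 + (Φ 1)⁻¹) ^ (1 / p) * Orlicz.rate Φ p N))) := by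
  refine ⟨?_, fun a ha N hN 𝕜 _ Ω _ _ _ _ μ _ CΦ hCΦ => ?_⟩
  · obtain ⟨a, ha⟩ := hap
    refine ⟨5 * (4 * a) * a ^ (2 / p) * (1 + (Φ 1)⁻¹) ^ (1 / p), ?_,
      fun N hN 𝕜 _ Ω _ _ _ _ μ _ => ?_⟩
    · have hK : 1 ≤ 5 * (4 * a) :=
        one_le_mul (by norm_num) (one_le_mul (by norm_num) ha.1)
      exact one_le_mul (one_le_mul hK (NNReal.one_le_rpow ha.1 (by positivity)))
        (NNReal.one_le_rpow le_self_add (by positivity))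
    · have hquasi : Orlicz.IsQuasiTriangleConst 𝕜 Φ μ (4 * a) :=
        (ha.mono_exponent (one_le_two.trans hp)).isQuasiTriangleConst hΦ
      simpa only [Orlicz.errorFactor, mul_assoc] using
        ha.samplingNumber_le_and_leastSquaresRecovers hΦ hp hΦ1 hN hquasi
  · simpa only [Orlicz.errorFactor, mul_assoc] using
      ha.samplingNumber_le_and_leastSquaresRecovers hΦ hp hΦ1 hN hCΦ

theorem theorem6p1 :
    ∃ c : ℕ, 1 ≤ c ∧ ∃ C : ℝ≥0, 1 ≤ C ∧
      ∀ (p : ℝ) (Φ : ℝ≥0 → ℝ≥0), 2 ≤ p → Orlicz.IsPhiFunction Φ → Orlicz.AInc Φ p → 0 < Φ 1 →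
        (∃ K : ℝ≥0, 1 ≤ K ∧
          ∀ (N : ℕ), 1 ≤ N →
          ∀ (𝕜 : Type) [RCLike 𝕜] (d : ℕ) (Ω : Set (EuclideanSpace ℝ (Fin d))) [CompactSpace Ω]
            (μ : Measure Ω) [IsProbabilityMeasure μ],
            (∀ F : Set C(Ω, 𝕜),
              Orlicz.samplingNumber Φ μ F (c * N) ≤
                (K * Orlicz.rate Φ p N : ℝ≥0) * Orlicz.kolmogorovWidth F N) ∧
            (∀ X : Submodule 𝕜 C(Ω, 𝕜), Module.finrank 𝕜 X = N →
              Orlicz.LeastSquaresRecovers Φ μ X (c * N) (K * Orlicz.rate Φ p N))) ∧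
        (∀ a : ℝ≥0, Orlicz.AIncWith Φ p a →
          ∀ (N : ℕ), 1 ≤ N →
          ∀ (𝕜 : Type) [RCLike 𝕜] (d : ℕ) (Ω : Set (EuclideanSpace ℝ (Fin d))) [CompactSpace Ω]
            (μ : Measure Ω) [IsProbabilityMeasure μ] (CΦ : ℝ≥0),
            Orlicz.IsQuasiTriangleConst 𝕜 Φ μ CΦ →
            (∀ F : Set C(Ω, 𝕜),
              Orlicz.samplingNumber Φ μ F (c * N) ≤
                (C * CΦ * a ^ (2 / p) * (1 + (Φ 1)⁻¹) ^ (1 / p) * Orlicz.rate Φ p N : ℝ≥0) *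
                  Orlicz.kolmogorovWidth F N) ∧
            (∀ X : Submodule 𝕜 C(Ω, 𝕜), Module.finrank 𝕜 X = N →
              Orlicz.LeastSquaresRecovers Φ μ X (c * N)
                (C * CΦ * a ^ (2 / p) * (1 + (Φ 1)⁻¹) ^ (1 / p) * Orlicz.rate Φ p N))) :=
  ⟨6, by norm_num, 5, by norm_num, fun _ _ hp hΦ hap hΦ1 =>
    have ⟨⟨K, hK, hgeneral⟩, hexplicit⟩ := theorem6p1_general hp hΦ.monotone hap hΦ1
    ⟨⟨K, hK, fun N hN 𝕜 _ _ Ω _ μ _ => hgeneral N hN 𝕜 Ω μ⟩,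
      fun a ha N hN 𝕜 _ _ Ω _ μ _ => hexplicit a ha N hN 𝕜 Ω μ⟩⟩
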